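/- All graphs are finite and simple. For a graph $G$, let $\rho(G)$ be the largest eigenvalue of its adjacency matrix. $K_s$ denotes the complete graph and $I_s$ the edgeless graph on $s$ vertices, $+$ denotes the disjoint union, and $G_1\vee G_2$ denotes the join, obtained from $G_1+G_2$ by adding all edges between $V(G_1)$ and $V(G_2)$. A graph is $m$-connected if it has more than $m$ vertices and it remains connected whenever fewer than $m$ vertices are deleted. Let $m\ge 1$ and $k\ge 2$ be integers, and let $G$ be an $m$-connected graph of order $$n\ \ge\ \max\left\{(7k-2)m+4,\ (k-1)m^2+\tfrac12(3k+1)m+\tfrac92\right\}.$$ If $$\rho(G)\ \ge\ \rho\bigl(K_m\vee(K_{n-km-1}+I_{km-m+1})\bigr),$$ then $G$ has a spanning tree of maximum degree at most $k$, unless $G$ is isomorphic to $K_m\vee(K_{n-km-1}+I_{km-m+1})$, in which case $G$ has no such spanning tree. -/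

import Mathlib

namespace SpanningKTree

/-- The join `G ∨ H`: the disjoint union of `G` and `H` together with all edges between
the two vertex sets. -/
def join {V W : Type*} (G : SimpleGraph V) (H : SimpleGraph W) : SimpleGraph (V ⊕ W) :=
  (G ⊕g H) ⊔ completeBipartiteGraph V W

/-- The graph `K_m ∨ (K_a + I_b)`, where `I_b` is the edgeless graph on `b` vertices and `+` is
the disjoint union. -/
def joinGraph (m a b : ℕ) : SimpleGraph (Fin m ⊕ (Fin a ⊕ Fin b)) :=
  join (⊤ : SimpleGraph (Fin m)) ((⊤ : SimpleGraph (Fin a)) ⊕g (⊥ : SimpleGraph (Fin b)))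

open Classical in
/-- The largest eigenvalue of the adjacency matrix of a finite graph with at least one vertex. -/
noncomputable def specRadius {V : Type*} [Fintype V] (G : SimpleGraph V) : ℝ :=
  sSup {μ : ℝ | Module.End.HasEigenvalue (Matrix.toLin' (G.adjMatrix ℝ)) μ}

/-- `G` is `m`-connected: it has more than `m` vertices, and it stays connected whenever fewer
than `m` vertices are deleted. -/
def IsMConnected {V : Type*} [Fintype V] (G : SimpleGraph V) (m : ℕ) : Prop :=
  m < Fintype.card V ∧
    ∀ S : Finset V, S.card < m → (G.induce {v : V | v ∉ S}).Connected

open Classical in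
/-- `G` has a spanning tree in which every vertex has degree at most `k`. -/
def HasSpanningKTree {V : Type*} [Fintype V] (G : SimpleGraph V) (k : ℕ) : Prop :=
  ∃ T : SimpleGraph V, T ≤ G ∧ T.IsTree ∧ ∀ v : V, T.degree v ≤ k

end SpanningKTree

/-!
If `G` has no spanning `k`-tree, enlarge it to an edge-maximal such graph `G'`. Adding a missing
edge `uv` to `G'` creates a spanning `k`-tree, in which `uv` separates the vertices into two parts.
An exchange argument in each part shows that few vertices lack a spanning tree of their part with
spare degree at them, and more so the larger the degrees of `u` and `v`. Those exceptional vertices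
meet every edge of `G'` between the parts, so there are at least `m` of them, and hence nonadjacent
vertices of `G'` have a small degree sum.

Hong's bound `ρ² ≤ 2e - n + 1` shows, on the other hand, that `G` has almost as many edges as
`K_m ∨ (K_a + I_b)`. For a degree-closed graph this is only possible if `b` vertices of degree `m`
share their neighbourhood and the other vertices form a clique, so `G'` is `K_m ∨ (K_a + I_b)`.
Finally `ρ(G') ≤ ρ(G)` with `G ≤ G'` and `G'` connected forces `G' = G`.
-/

namespace SpanningKTree

open Finset SimpleGraph

section Connectivity

variable {V W : Type*}

lemma connected_of_exists_adj_lt {G : SimpleGraph V} (f : V → ℕ) (u : V)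
    (h : ∀ z, z ≠ u → ∃ y, G.Adj z y ∧ f y < f z) : G.Connected := by
  have reachable (n : ℕ) : ∀ z, f z = n → G.Reachable z u := by
    induction n using Nat.strong_induction_on with
    | _ n ih =>
      rintro z rfl
      obtain rfl | hz := eq_or_ne z u
      · rfl
      · obtain ⟨y, hzy, hlt⟩ := h z hz
        exact hzy.reachable.trans (ih _ hlt y rfl)
  exact connected_iff_exists_forall_reachable G |>.2 ⟨u, fun z ↦ (reachable _ z rfl).symm⟩

lemma exists_adj_dist_lt {G : SimpleGraph V} (hG : G.Connected) {u z : V} (hz : z ≠ u) :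
    ∃ y, G.Adj z y ∧ G.dist u y < G.dist u z := by
  obtain ⟨p, hp⟩ := hG.exists_walk_length_eq_dist z u
  cases p with
  | nil => exact absurd rfl hz
  | cons hzy q =>
    refine ⟨_, hzy, ?_⟩
    rw [G.dist_comm, G.dist_comm (u := u), ← hp, Walk.length_cons, Nat.lt_succ_iff]
    exact dist_le q

lemma induce_connected_of_dist_lt {G : SimpleGraph V} (hG : G.Connected) {u : V} {U : Set V}
    (hu : u ∈ U) (h : ∀ ⦃z y⦄, z ∈ U → G.Adj z y → G.dist u y < G.dist u z → y ∈ U) :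
    (G.induce U).Connected := by
  refine connected_of_exists_adj_lt (fun z ↦ G.dist u z) ⟨u, hu⟩ fun z hz ↦ ?_
  obtain ⟨y, hzy, hlt⟩ := exists_adj_dist_lt hG (Subtype.coe_ne_coe.2 hz)
  exact ⟨⟨y, h z.2 hzy hlt⟩, hzy, hlt⟩

lemma exists_induce_connected_of_adj {T : SimpleGraph V} (hT : T.Connected) {u v : V}
    (huv : T.Adj u v) :
    ∃ U : Set V, u ∈ U ∧ v ∉ U ∧ (T.induce U).Connected ∧ (T.induce Uᶜ).Connected := by
  let U : Set V := {z | T.dist u z < T.dist v z}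
  have hu : u ∈ U := by simpa [U] using hT.pos_dist_of_ne huv.ne'
  have hv : v ∉ U := by simp [U]
  refine ⟨U, hu, hv, induce_connected_of_dist_lt hT hu fun z y hz hzy hlt ↦ ?_,
    induce_connected_of_dist_lt hT hv fun z y hz hzy hlt ↦ ?_⟩
  · have := hzy.diff_dist_adj (u := v)
    simp only [U, Set.mem_ofPred_eq] at hz ⊢
    lia
  · have := hzy.diff_dist_adj (u := u)
    simp only [U, Set.mem_compl_iff, Set.mem_ofPred_eq] at hz ⊢
    lia

lemma adj_of_le_sup_edge {G H : SimpleGraph V} {u v : V} (hHG : H ≤ G ⊔ edge u v)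
    (hH : ¬H ≤ G) : H.Adj u v := by
  contrapose! hH
  refine fun x y hxy ↦ (hHG hxy).resolve_right fun h ↦ hH ?_
  obtain ⟨⟨rfl, rfl⟩ | ⟨rfl, rfl⟩, -⟩ := (edge_adj ..).1 h
  exacts [hxy, hxy.symm]

lemma IsMConnected.exists_adj_of_card_lt [Fintype V] {G : SimpleGraph V} {m : ℕ}
    (hG : IsMConnected G m) {S : Finset V} (hS : #S < m) {A : Set V} {a b : V}
    (ha : a ∈ A) (haS : a ∉ S) (hb : b ∉ A) (hbS : b ∉ S) :
    ∃ x ∈ A, ∃ y ∉ A, x ∉ S ∧ y ∉ S ∧ G.Adj x y := by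
  obtain ⟨p⟩ := (hG.2 S hS).preconnected ⟨a, haS⟩ ⟨b, hbS⟩
  obtain ⟨d, -, hd, hd'⟩ := p.exists_boundary_dart (Subtype.val ⁻¹' A) ha hb
  exact ⟨d.fst, hd, d.snd, hd', d.fst.2, d.snd.2, d.adj⟩

lemma IsMConnected.connected [Fintype V] {G : SimpleGraph V} {m : ℕ} (hG : IsMConnected G m)
    (hm : 1 ≤ m) : G.Connected := by
  have huniv : {v : V | v ∉ (∅ : Finset V)} = Set.univ := by simp
  have h := hG.2 ∅ (by rwa [card_empty])
  rw [huniv] at h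
  exact G.induceUnivIso.connected_iff.1 h

lemma IsMConnected.mono [Fintype V] {G H : SimpleGraph V} {m : ℕ} (hG : IsMConnected G m)
    (h : G ≤ H) : IsMConnected H m :=
  ⟨hG.1, fun S hS ↦ (hG.2 S hS).mono fun _ _ hxy ↦ h hxy⟩

lemma IsMConnected.le_degree [Fintype V] {G : SimpleGraph V} [DecidableRel G.Adj] {m : ℕ}
    (hG : IsMConnected G m) (v : V) : m ≤ G.degree v := by
  classical
  by_contra! hlt
  have hcard : #(insert v (G.neighborFinset v)) < Fintype.card V := by
    have := card_insert_le v (G.neighborFinset v)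
    rw [card_neighborFinset_eq_degree] at this
    have := hG.1
    lia
  obtain ⟨b, -, hb⟩ := exists_mem_notMem_of_card_lt_card (hcard.trans_eq card_univ.symm)
  rw [mem_insert, not_or] at hb
  obtain ⟨x, rfl, y, -, -, hy, hxy⟩ := hG.exists_adj_of_card_lt (A := {v})
    ((G.card_neighborFinset_eq_degree v).trans_lt hlt) rfl (by simp) hb.1 hb.2
  exact hy ((G.mem_neighborFinset x y).2 hxy)

lemma degree_sum_inl (C : SimpleGraph V) (D : SimpleGraph W) (v : V) [Fintype (C.neighborSet v)]
    [Fintype ((C ⊕g D).neighborSet (.inl v))] : (C ⊕g D).degree (.inl v) = C.degree v := by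
  rw [← card_neighborFinset_eq_degree, ← card_neighborFinset_eq_degree,
    ← card_map (s := C.neighborFinset v) Function.Embedding.inl]
  congr 1
  ext (z | z) <;> simp

lemma degree_sum_inr (C : SimpleGraph V) (D : SimpleGraph W) (w : W) [Fintype (D.neighborSet w)]
    [Fintype ((C ⊕g D).neighborSet (.inr w))] : (C ⊕g D).degree (.inr w) = D.degree w := by
  rw [← card_neighborFinset_eq_degree, ← card_neighborFinset_eq_degree,
    ← card_map (s := D.neighborFinset w) Function.Embedding.inr]
  congr 1
  ext (z | z) <;> simp

end Connectivity

section SpanningTrees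

variable {V W : Type*} [Fintype V] [Fintype W]

lemma hasSpanningKTree_of_bijective {G : SimpleGraph V} {C : SimpleGraph W} [DecidableRel C.Adj]
    {k : ℕ} (f : C →g G) (hf : f.toFun.Bijective) (hC : C.Connected)
    (hdeg : ∀ w, C.degree w ≤ k) : HasSpanningKTree G k := by
  classical
  obtain ⟨T, hTC, hT⟩ := hC.exists_isTree_le
  let e : W ≃ V := Equiv.ofBijective f hf
  let φ : T ≃g T.map e.toEmbedding := Iso.map e T
  refine ⟨T.map e.toEmbedding, ?_, φ.isTree_iff.1 hT, fun v ↦ ?_⟩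
  · rintro _ _ ⟨-, x, y, hxy, rfl, rfl⟩
    exact f.map_rel (hTC hxy)
  · obtain ⟨w, rfl⟩ := φ.surjective v
    rw [φ.degree_eq]
    exact (degree_le_of_le hTC).trans (hdeg w)

lemma HasSpanningKTree.of_iso {G : SimpleGraph V} {H : SimpleGraph W} {k : ℕ}
    (hG : HasSpanningKTree G k) (φ : G ≃g H) : HasSpanningKTree H k := by
  classical
  obtain ⟨T, hTG, hT, hdeg⟩ := hG
  exact hasSpanningKTree_of_bijective (φ.toHom.comp (Hom.ofLE hTG)) φ.bijective
    hT.connected hdeg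

lemma hasSpanningKTree_top [Nonempty V] {k : ℕ} (hk : 2 ≤ k) :
    HasSpanningKTree (⊤ : SimpleGraph V) k := by
  classical
  obtain ⟨n, hn⟩ := Nat.exists_eq_succ_of_ne_zero (Fintype.card_ne_zero (α := V))
  let e := (Fintype.equivFinOfCardEq hn).symm
  refine hasSpanningKTree_of_bijective (C := pathGraph (n + 1))
    ⟨e, fun h ↦ e.injective.ne h.ne⟩ e.bijective (pathGraph_connected n) fun i ↦ le_trans ?_ hk
  have hsub : ((pathGraph (n + 1)).neighborFinset i).map Fin.valEmbedding ⊆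
      {(i : ℕ) + 1, (i : ℕ) - 1} := by
    intro j hj
    simp only [mem_map, mem_neighborFinset, pathGraph_adj, Fin.valEmbedding_apply] at hj
    obtain ⟨i, hi, rfl⟩ := hj
    simp only [mem_insert, mem_singleton]
    lia
  rw [← card_neighborFinset_eq_degree, ← card_map Fin.valEmbedding]
  exact (card_le_card hsub).trans card_le_two

lemma degree_sup_edge_le [DecidableEq V] (G : SimpleGraph V)
    [DecidableRel G.Adj] (x y v : V) :
    (G ⊔ edge x y).degree v ≤ G.degree v + if v = x ∨ v = y then 1 else 0 := by
  rw [← card_neighborFinset_eq_degree, neighborFinset_sup, ← card_neighborFinset_eq_degree G]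
  refine (card_union_le _ _).trans (Nat.add_le_add_left ?_ _)
  split_ifs with h
  · have hsub : (edge x y).neighborFinset v ⊆ {if v = x then y else x} := fun z hz ↦ by
      simp only [mem_neighborFinset, edge_adj] at hz
      grind
    simpa using card_le_card hsub
  · rw [Nat.le_zero, card_eq_zero, eq_empty_iff_forall_notMem]
    intro z hz
    simp only [mem_neighborFinset, edge_adj] at hz
    grind

lemma degree_sup_edge_le_of_lt [DecidableEq V] {G : SimpleGraph V}
    [DecidableRel G.Adj] {k : ℕ} (hG : ∀ v, G.degree v ≤ k) {x y : V} (hx : G.degree x < k)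
    (hy : G.degree y < k) (v : V) : (G ⊔ edge x y).degree v ≤ k := by
  have := degree_sup_edge_le G x y v
  have := hG v
  split_ifs at * with hv
  · rcases hv with rfl | rfl <;> lia
  · lia

open Classical in
/-- `H` has a connected spanning subgraph of maximum degree at most `k` in which `x` has degree
less than `k`, so that one more edge may be attached at `x`. -/
def HasSpareDegree (H : SimpleGraph W) (k : ℕ) (x : W) : Prop :=
  ∃ C ≤ H, C.Connected ∧ (∀ w, C.degree w ≤ k) ∧ C.degree x < k

lemma HasSpareDegree.hasSpanningKTree {G : SimpleGraph V} {k : ℕ} {U : Set V}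
    [Fintype U] [Fintype ↥Uᶜ] {x y : V}
    (hx : x ∈ U) (hy : y ∈ Uᶜ) (hxy : G.Adj x y)
    (hU : HasSpareDegree (G.induce U) k ⟨x, hx⟩)
    (hUc : HasSpareDegree (G.induce Uᶜ) k ⟨y, hy⟩) : HasSpanningKTree G k := by
  classical
  obtain ⟨C, hCG, hC, hCdeg, hCx⟩ := hU
  obtain ⟨D, hDG, hD, hDdeg, hDy⟩ := hUc
  let f : ((C ⊕g D) ⊔ edge (.inl ⟨x, hx⟩) (.inr ⟨y, hy⟩)) →g G :=
    ⟨Equiv.Set.sumCompl U, by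
      rintro (a | a) (b | b) h
      · exact hCG (by simpa [edge_adj] using h)
      · obtain ⟨rfl, rfl⟩ : a = ⟨x, hx⟩ ∧ b = ⟨y, hy⟩ := by simpa [edge_adj] using h
        exact hxy
      · obtain ⟨rfl, rfl⟩ : b = ⟨x, hx⟩ ∧ a = ⟨y, hy⟩ := by
          simpa [edge_adj, and_comm, eq_comm] using h
        exact hxy.symm
      · exact hDG (by simpa [edge_adj] using h)⟩
  refine hasSpanningKTree_of_bijective f (Equiv.Set.sumCompl U).bijective (hC.sum_sup_edge hD)
    (degree_sup_edge_le_of_lt ?_ (by rwa [degree_sum_inl]) (by rwa [degree_sum_inr]))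
  rintro (w | w)
  · rw [degree_sum_inl]
    exact hCdeg w
  · rw [degree_sum_inr]
    exact hDdeg w

lemma eq_of_adj_of_dist_lt {V : Type*} {T : SimpleGraph V} (hT : T.IsTree) {u x y z : V}
    (hx : T.Adj x z) (hxz : T.dist u x < T.dist u z) (hy : T.Adj y z)
    (hyz : T.dist u y < T.dist u z) : x = y := by
  have geodesic {w : V} (hw : T.Adj w z) (hwz : T.dist u w < T.dist u z) :
      ∃ p : T.Walk u z, p.IsPath ∧ p.penultimate = w := by
    obtain ⟨p, hp⟩ := hT.connected.exists_walk_length_eq_dist u w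
    refine ⟨p.concat hw, Walk.isPath_of_length_eq_dist _ ?_, p.penultimate_concat hw⟩
    rw [Walk.length_concat, hp]
    have := hT.dist_eq_dist_add_one_of_adj u hw
    lia
  obtain ⟨p, hp, rfl⟩ := geodesic hx hxz
  obtain ⟨q, hq, rfl⟩ := geodesic hy hyz
  have := hT.isAcyclic.subsingleton_path u z
  rw [Subtype.mk.inj (Subsingleton.elim (⟨p, hp⟩ : T.Path u z) ⟨q, hq⟩)]

/-- The children of the vertex `x` in the tree `T` rooted at `u`. -/
noncomputable def children (T : SimpleGraph V) [DecidableRel T.Adj] (u x : V) : Finset V :=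
  {c ∈ T.neighborFinset x | T.dist u x < T.dist u c}

lemma mem_children {T : SimpleGraph V} [DecidableRel T.Adj] {u x c : V} :
    c ∈ children T u x ↔ T.Adj x c ∧ T.dist u x < T.dist u c := by
  simp [children]

lemma degree_le_card_children_add_one {T : SimpleGraph V} [DecidableRel T.Adj] (hT : T.IsTree)
    (u x : V) : T.degree x ≤ #(children T u x) + 1 := by
  rw [← card_neighborFinset_eq_degree,
    ← card_filter_add_card_filter_not (s := T.neighborFinset x) fun c ↦ T.dist u x < T.dist u c]
  refine Nat.add_le_add_left (card_le_one.2 fun y hy z hz ↦ ?_) _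
  have parent {w : V} (hw : w ∈ (T.neighborFinset x).filter (¬T.dist u x < T.dist u ·)) :
      T.Adj w x ∧ T.dist u w < T.dist u x := by
    obtain ⟨hw, hle⟩ := mem_filter.1 hw
    rw [mem_neighborFinset] at hw
    exact ⟨hw.symm, (not_lt.1 hle).lt_of_ne (hT.dist_ne_of_adj u hw).symm⟩
  exact eq_of_adj_of_dist_lt hT (parent hy).1 (parent hy).2 (parent hz).1 (parent hz).2

lemma disjoint_children {T : SimpleGraph V} [DecidableRel T.Adj] (hT : T.IsTree) (u : V)
    {x y : V} (hxy : x ≠ y) : Disjoint (children T u x) (children T u y) := by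
  refine disjoint_left.2 fun c hx hy ↦ hxy ?_
  rw [mem_children] at hx hy
  exact eq_of_adj_of_dist_lt hT hx.1 hx.2 hy.1 hy.2

lemma degree_deleteEdges_lt [DecidableEq V] {G : SimpleGraph V} [DecidableRel G.Adj] {x y : V}
    (h : G.Adj x y) : (G.deleteEdges {s(x, y)}).degree x < G.degree x := by
  rw [← card_neighborFinset_eq_degree, ← card_neighborFinset_eq_degree]
  refine card_lt_card ((ssubset_iff_of_subset fun z hz ↦ ?_).2 ⟨y, by simpa using h, by simp⟩)
  rw [mem_neighborFinset] at hz ⊢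
  exact deleteEdges_le _ hz

/-- Exchange argument: the child `c` of `x` is reattached to the root `u`. -/
lemma hasSpareDegree_of_adj_of_mem_children {H T : SimpleGraph V} [DecidableRel T.Adj] {k : ℕ}
    {u x c : V} (hTH : T ≤ H) (hT : T.Connected) (hdeg : ∀ v, T.degree v ≤ k)
    (hu : T.degree u < k) (hc : c ∈ children T u x) (huc : H.Adj u c) : HasSpareDegree H k x := by
  classical
  obtain ⟨hxc, hlt⟩ := mem_children.1 hc
  obtain rfl | hxu := eq_or_ne x u
  · exact ⟨T, hTH, hT, by convert hdeg, by convert hu⟩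
  have hle (v : V) : (T.deleteEdges {s(x, c)}).degree v ≤ T.degree v :=
    degree_le_of_le (deleteEdges_le _)
  have hdelx := degree_deleteEdges_lt hxc
  have hdelc := degree_deleteEdges_lt hxc.symm
  rw [Sym2.eq_swap] at hdelc
  refine ⟨T.deleteEdges {s(x, c)} ⊔ edge u c, sup_le ((deleteEdges_le _).trans hTH)
    ((edge_le_iff _).2 (.inr huc)), ?_, fun v ↦ ?_, ?_⟩
  · refine connected_of_exists_adj_lt (T.dist u) u fun z hz ↦ ?_
    obtain rfl | hzc := eq_or_ne z c
    · exact ⟨u, by simp [edge_adj, huc.ne'], by simpa using hT.pos_dist_of_ne hz.symm⟩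
    · obtain ⟨y, hzy, hlt'⟩ := exists_adj_dist_lt hT hz
      refine ⟨y, .inl (deleteEdges_adj.2 ⟨hzy, ?_⟩), hlt'⟩
      rintro h
      obtain ⟨rfl, rfl⟩ | ⟨rfl, rfl⟩ := Sym2.eq_iff.1 h
      · exact hlt.not_gt hlt'
      · exact hzc rfl
  · convert degree_sup_edge_le_of_lt (fun v ↦ (hle v).trans (hdeg v)) ((hle u).trans_lt hu)
      (hdelc.trans_le (hdeg c)) v
  · have := degree_sup_edge_le (T.deleteEdges {s(x, c)}) u c x
    rw [if_neg (by simp [hxu, hxc.ne]), add_zero] at this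
    convert Nat.lt_of_le_of_lt this (hdelx.trans_le (hdeg x))

open Classical in
lemma degree_add_mul_card_add_one_le {H T : SimpleGraph V} {k : ℕ} {u : V} (hTH : T ≤ H)
    (hT : T.IsTree) (hdeg : ∀ v, T.degree v ≤ k) (hu : T.degree u < k) :
    H.degree u + (k - 1) * #{x | ¬HasSpareDegree H k x} + 1 ≤ Fintype.card V := by
  set X : Finset V := {x | ¬HasSpareDegree H k x}
  have card_children (x : V) (hx : x ∈ X) : k - 1 ≤ #(children T u x) := by
    have hk : k ≤ T.degree x := by
      by_contra! hlt
      exact (mem_filter.1 hx).2 ⟨T, hTH, hT.connected, hdeg, hlt⟩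
    have := degree_le_card_children_add_one hT u x
    lia
  have hdisj : Disjoint (H.neighborFinset u) (X.biUnion (children T u)) := by
    refine disjoint_left.2 fun c huc hc ↦ ?_
    obtain ⟨x, hx, hcx⟩ := mem_biUnion.1 hc
    exact (mem_filter.1 hx).2 (hasSpareDegree_of_adj_of_mem_children hTH hT.connected hdeg hu hcx
      ((H.mem_neighborFinset u c).1 huc))
  have hnot : u ∉ H.neighborFinset u ∪ X.biUnion (children T u) := by
    simp [mem_children]
  calc H.degree u + (k - 1) * #X + 1
      ≤ #(H.neighborFinset u) + #(X.biUnion (children T u)) + 1 := by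
        rw [card_biUnion fun x _ y _ ↦ disjoint_children hT u, card_neighborFinset_eq_degree,
          mul_comm, ← smul_eq_mul]
        gcongr
        exact card_nsmul_le_sum _ _ _ card_children
    _ = #(insert u (H.neighborFinset u ∪ X.biUnion (children T u))) := by
        rw [card_insert_of_notMem hnot, card_union_of_disjoint hdisj]
    _ ≤ Fintype.card V := card_le_univ _

lemma degree_induce_lt {G : SimpleGraph V} [DecidableRel G.Adj] {U : Set V}
    [DecidablePred (· ∈ U)] {u v : V} (hu : u ∈ U) (hv : v ∉ U) (huv : G.Adj u v) :
    (G.induce U).degree ⟨u, hu⟩ < G.degree u := by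
  classical
  rw [← card_neighborFinset_eq_degree, ← card_map (.subtype (· ∈ U)),
    map_neighborFinset_induce, ← card_neighborFinset_eq_degree]
  refine card_lt_card ((ssubset_iff_of_subset inter_subset_left).2 ⟨v, ?_, ?_⟩) <;> simp [huv, hv]

lemma degree_induce_le (G : SimpleGraph V) [DecidableRel G.Adj] {U : Set V}
    [DecidablePred (· ∈ U)] (u : U) : (G.induce U).degree u ≤ G.degree u := by
  classical
  rw [← card_neighborFinset_eq_degree, ← card_map (.subtype (· ∈ U)),
    map_neighborFinset_induce, ← card_neighborFinset_eq_degree]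
  exact card_le_card inter_subset_left

lemma degree_le_degree_induce_add_card {G : SimpleGraph V} [DecidableRel G.Adj] {U : Set V}
    [DecidablePred (· ∈ U)] {u : V} (hu : u ∈ U) {Y : Finset V}
    (hY : ∀ y ∉ U, G.Adj u y → y ∈ Y) : G.degree u ≤ (G.induce U).degree ⟨u, hu⟩ + #Y := by
  classical
  rw [← card_neighborFinset_eq_degree, ← card_neighborFinset_eq_degree,
    ← card_map (s := (G.induce U).neighborFinset _) (.subtype (· ∈ U)), map_neighborFinset_induce]
  refine (card_le_card fun y hy ↦ ?_).trans (card_union_le _ Y)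
  by_cases hyU : y ∈ U
  · simp_all
  · exact mem_union_right _ (hY y hyU (by simpa using hy))

open Classical in
lemma hasSpareDegree_and_degree_induce_add_le {G T : SimpleGraph V} [DecidableRel G.Adj] {k : ℕ}
    {U : Set V} [DecidablePred (· ∈ U)] {u v : V} (hTG : T ≤ G ⊔ edge u v) (hT : T.IsAcyclic)
    (hdeg : ∀ z, T.degree z ≤ k) (huv : T.Adj u v) (hu : u ∈ U) (hv : v ∉ U)
    (hU : (T.induce U).Connected) :
    HasSpareDegree (G.induce U) k ⟨u, hu⟩ ∧
      (G.induce U).degree ⟨u, hu⟩ + (k - 1) * #{x | ¬HasSpareDegree (G.induce U) k x} + 1 ≤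
        Fintype.card U := by
  have hle : T.induce U ≤ G.induce U := fun x y hxy ↦ by
    refine (hTG (show T.Adj x y from hxy)).resolve_right fun h ↦ ?_
    have := x.2
    have := y.2
    simp only [edge_adj] at h
    grind
  have hdegU (x : U) : (T.induce U).degree x ≤ k := by
    convert (degree_induce_le T x).trans (hdeg x)
  have hdegu : (T.induce U).degree ⟨u, hu⟩ < k := by
    convert (degree_induce_lt hu hv huv).trans_le (hdeg u)
  refine ⟨⟨_, hle, hU, hdegU, hdegu⟩, ?_⟩
  convert degree_add_mul_card_add_one_le hle ⟨hU, hT.induce U⟩ hdegU hdegu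

theorem degree_add_degree_add_le_of_hasSpanningKTree_sup_edge {G : SimpleGraph V}
    [DecidableRel G.Adj] {m k : ℕ} (hG : IsMConnected G m) (hk : 2 ≤ k)
    (hGk : ¬HasSpanningKTree G k) {u v : V} (hGuv : HasSpanningKTree (G ⊔ edge u v) k) :
    G.degree u + G.degree v + (k - 2) * m + 2 ≤ Fintype.card V := by
  classical
  obtain ⟨T, hTG, hT, hdeg⟩ := hGuv
  have huv : T.Adj u v := adj_of_le_sup_edge hTG fun hle ↦ hGk ⟨T, hle, hT, hdeg⟩
  obtain ⟨U, hu, hv, hU, hUc⟩ := exists_induce_connected_of_adj hT.connected huv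
  obtain ⟨hspareu, hcardU⟩ :=
    hasSpareDegree_and_degree_induce_add_le hTG hT.isAcyclic hdeg huv hu hv hU
  obtain ⟨hsparev, hcardUc⟩ := hasSpareDegree_and_degree_induce_add_le
    (edge_comm u v ▸ hTG) hT.isAcyclic hdeg huv.symm hv (not_not.2 hu) hUc
  let X : Finset V := .map (.subtype _) {x | ¬HasSpareDegree (G.induce U) k x}
  let Y : Finset V := .map (.subtype _) {y | ¬HasSpareDegree (G.induce Uᶜ) k y}
  have mem_X_or_mem_Y {x y : V} (hx : x ∈ U) (hy : y ∉ U) (hxy : G.Adj x y) : x ∈ X ∨ y ∈ Y := by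
    by_contra! h
    refine hGk (HasSpareDegree.hasSpanningKTree hx hy hxy ?_ ?_)
    · simpa [X, hx] using h.1
    · simpa [Y, hy] using h.2
  have huX : u ∉ X := by simp [X, hu, hspareu]
  have hvY : v ∉ Y := by simpa [Y, hv] using hsparev
  have hXU : ∀ x ∈ X, x ∈ U := by simp +contextual [X]
  have hYU : ∀ y ∈ Y, y ∉ U := by simp +contextual [Y]
  have hm : m ≤ #X + #Y := by
    by_contra! hlt
    obtain ⟨x, hx, y, hy, hxS, hyS, hxy⟩ := hG.exists_adj_of_card_lt
      ((card_union_le X Y).trans_lt hlt) hu (by grind) hv (by grind)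
    grind
  have hdegu := degree_le_degree_induce_add_card hu (Y := Y)
    fun y hy huy ↦ (mem_X_or_mem_Y hu hy huy).resolve_left huX
  have hdegv := degree_le_degree_induce_add_card (U := Uᶜ) hv (Y := X)
    fun x hx hvx ↦ (mem_X_or_mem_Y (not_not.1 hx) hv hvx.symm).resolve_right hvY
  have hcard : Fintype.card U + Fintype.card ↥Uᶜ = Fintype.card V := by
    rw [← Fintype.card_sum]
    exact Fintype.card_congr (Equiv.Set.sumCompl U)
  rw [← show #X = _ from card_map _] at hcardU
  rw [← show #Y = _ from card_map _] at hcardUc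
  obtain ⟨j, rfl⟩ := Nat.exists_eq_add_of_le' hk
  simp only [Nat.add_sub_cancel, show j + 2 - 1 = j + 1 by lia] at hcardU hcardUc ⊢
  have := Nat.mul_le_mul_left j hm
  linarith

end SpanningTrees

section EdgeCount

variable {V : Type*} [Fintype V]

lemma card_edgeFinset_le_sum_degree_add {G : SimpleGraph V} [DecidableRel G.Adj] {S W : Finset V}
    (h : ∀ ⦃x y⦄, G.Adj x y → x ∉ S → y ∉ S → x ∈ W) :
    #G.edgeFinset ≤ ∑ v ∈ S, G.degree v + #(G.induce (W : Set V)).edgeFinset := by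
  classical
  calc #G.edgeFinset
      ≤ #((S.biUnion fun v ↦ G.incidenceFinset v) ∪ {e ∈ G.edgeFinset | e.toFinset ⊆ W}) := by
        refine card_le_card fun e he ↦ ?_
        induction e with
        | _ x y =>
          rw [mem_edgeFinset, mem_edgeSet] at he
          have := h he
          have := h he.symm
          simp only [mem_union, mem_biUnion, mem_incidenceFinset, mk'_mem_incidenceSet_iff,
            mem_filter, mem_edgeFinset, mem_edgeSet, Sym2.toFinset_mk_eq]
          grind
    _ ≤ ∑ v ∈ S, G.degree v + #(G.induce (W : Set V)).edgeFinset := by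
        refine (card_union_le _ _).trans (add_le_add (card_biUnion_le.trans_eq ?_)
          (card_filter_edgeFinset_toFinset_subset W).le)
        exact sum_congr rfl fun v _ ↦ card_incidenceFinset_eq_degree G v

lemma card_edgeFinset_lt_of_isAcyclic [Nonempty V] {G : SimpleGraph V} [DecidableRel G.Adj]
    (hG : G.IsAcyclic) : #G.edgeFinset < Fintype.card V := by
  classical
  obtain ⟨T, hGT, -, hT⟩ :=
    (connected_top (V := V)).exists_isTree_le_of_le_of_isAcyclic le_top hG
  rw [← hT.card_edgeFinset]
  exact Nat.lt_succ_of_le (card_le_card (edgeFinset_mono hGT))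

lemma card_le_sum_degree_add_card {T : SimpleGraph V} [DecidableRel T.Adj] (hT : T.IsTree)
    {S W : Finset V} (hW : W.Nonempty) (h : ∀ ⦃x y⦄, T.Adj x y → x ∉ S → y ∉ S → x ∈ W) :
    Fintype.card V ≤ ∑ v ∈ S, T.degree v + #W := by
  classical
  have : Nonempty (W : Set V) := hW.coe_sort
  have hforest := card_edgeFinset_lt_of_isAcyclic (hT.isAcyclic.induce (W : Set V))
  have hsum := card_edgeFinset_le_sum_degree_add h
  have hcardW : Fintype.card (W : Set V) = #W := by simp
  have := hT.card_edgeFinset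
  lia

lemma not_hasSpanningKTree_joinGraph {m a b k : ℕ} (ha : 1 ≤ a)
    (hb : (k - 1) * m + 1 ≤ b) : ¬HasSpanningKTree (joinGraph m a b) k := by
  classical
  rintro ⟨T, hTG, hT, hdeg⟩
  let S : Finset (Fin m ⊕ (Fin a ⊕ Fin b)) := univ.map .inl
  let W : Finset (Fin m ⊕ (Fin a ⊕ Fin b)) := univ.map (.trans .inl .inr)
  have hW : W.Nonempty := by
    rw [← card_pos, card_map, card_univ, Fintype.card_fin]
    exact ha
  have hcover ⦃x y⦄ (hxy : T.Adj x y) (hx : x ∉ S) (hy : y ∉ S) : x ∈ W := by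
    have := hTG hxy
    rcases x with x | x | x <;> rcases y with y | y | y <;> simp_all [S, W, joinGraph, join]
  have hle := card_le_sum_degree_add_card hT hW hcover
  have hS : ∑ v ∈ S, T.degree v ≤ #S * k := sum_le_card_nsmul _ _ _ fun v _ ↦ hdeg v
  simp only [S, W, card_map, card_univ, Fintype.card_sum, Fintype.card_fin] at hle hS
  cases k <;> lia

end EdgeCount

section DegreeClosed

/-- A graph is `c`-closed in the sense of Bondy and Chvátal if vertices whose degrees sum to at
least `c` are adjacent. Maximal graphs without a spanning `k`-tree are closed, which is what
determines their structure when they have many edges. -/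
def IsDegreeClosed {V : Type*} (G : SimpleGraph V) [G.LocallyFinite] (c : ℕ) : Prop :=
  ∀ ⦃u v⦄, u ≠ v → c ≤ G.degree u + G.degree v → G.Adj u v

variable {V : Type*} [Fintype V] {G : SimpleGraph V} [DecidableRel G.Adj] {m b N : ℕ}

lemma two_mul_card_edgeFinset_add_card_compl_le [DecidableEq V] (W : Finset V) :
    2 * #G.edgeFinset + #Wᶜ ≤ #Wᶜ ^ 2 + 2 * ∑ w ∈ W, G.degree w := by
  have h := card_edgeFinset_le_sum_degree_add (G := G) (S := W) (W := Wᶜ)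
    fun x _ _ hx _ ↦ mem_compl.2 hx
  have hchoose := card_edgeFinset_le_card_choose_two (G := G.induce ((Wᶜ : Finset V) : Set V))
  have hcard : Fintype.card ((Wᶜ : Finset V) : Set V) = #Wᶜ := Fintype.card_coe _
  rw [hcard] at hchoose
  have hsq : #Wᶜ * (#Wᶜ - 1) + #Wᶜ = #Wᶜ ^ 2 := by cases #Wᶜ <;> simp; ring
  have := Nat.choose_two_right #Wᶜ
  have := Nat.div_mul_le_self (#Wᶜ * (#Wᶜ - 1)) 2
  lia

lemma exists_not_adj_forall_degree_le (hG : G ≠ ⊤) :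
    ∃ u v, u ≠ v ∧ ¬G.Adj u v ∧ G.degree u ≤ G.degree v ∧
      ∀ x, x ≠ v → ¬G.Adj x v → G.degree x ≤ G.degree u := by
  classical
  obtain ⟨u₀, v₀, hne₀, hadj₀⟩ : ∃ u v, u ≠ v ∧ ¬G.Adj u v := by
    contrapose! hG
    exact eq_top_iff.2 fun u v huv ↦ hG u v huv
  obtain ⟨⟨u, v⟩, huv, hmax⟩ := exists_max_image {p : V × V | p.1 ≠ p.2 ∧ ¬G.Adj p.1 p.2}
    (fun p ↦ G.degree p.1 + G.degree p.2) ⟨(u₀, v₀), by simp [hne₀, hadj₀]⟩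
  simp only [mem_filter, mem_univ, true_and, Prod.forall, and_imp] at huv hmax
  rcases le_total (G.degree u) (G.degree v) with hle | hle
  · refine ⟨u, v, huv.1, huv.2, hle, fun x hx hxv ↦ ?_⟩
    have := hmax x v hx hxv
    lia
  · refine ⟨v, u, huv.1.symm, fun h ↦ huv.2 h.symm, hle, fun x hx hxu ↦ ?_⟩
    have := hmax x u hx hxu
    lia

lemma IsDegreeClosed.exists_le_card_filter_degree_le (hcl : IsDegreeClosed G (N + m))
    (hV : Fintype.card V = N + b) (hδ : ∀ v, m ≤ G.degree v) (hG : G ≠ ⊤) :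
    ∃ t, 2 * t + m < N ∧ b + t ≤ #{x | G.degree x ≤ m + t} := by
  classical
  obtain ⟨u, v, hne, hadj, hle, hmax⟩ := exists_not_adj_forall_degree_le hG
  obtain ⟨t, ht⟩ := Nat.exists_eq_add_of_le (hδ u)
  have hlt : G.degree u + G.degree v < N + m := by
    contrapose! hadj
    exact hcl hne hadj
  refine ⟨t, by lia, ?_⟩
  have hcard : #(insert v (G.neighborFinset v))ᶜ + (G.degree v + 1) = N + b := by
    rw [← hV, ← G.card_neighborFinset_eq_degree,
      ← card_insert_of_notMem (G.notMem_neighborFinset_self v), card_compl_add_card]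
  calc b + t ≤ #(insert v (G.neighborFinset v))ᶜ := by lia
    _ ≤ #{x | G.degree x ≤ m + t} := card_le_card fun x hx ↦ by
        rw [mem_compl, mem_insert, mem_neighborFinset, not_or, G.adj_comm] at hx
        simpa [← ht] using hmax x hx.1 hx.2

/-- The difference of the two sides is a convex quadratic in `t`, so that it suffices to bound it
at the ends `1` and `(N - m - 1) / 2` of the range of `t`. -/
lemma sub_sq_add_two_mul_lt {N b m t : ℤ} (hm : 1 ≤ m) (hmb : m + 1 ≤ b)
    (h1 : 2 * b * m + b + 2 * m + 6 ≤ 2 * N) (h2 : 6 * b + 5 * m ≤ N + 3)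
    (ht : 1 ≤ t) (htN : 2 * t + m + 1 ≤ N) :
    (N - t) ^ 2 + 2 * ((b + t) * (m + t)) < N ^ 2 + b - t := by
  set r := 1 + 2 * b + 2 * m - 2 * N with _
  set s := 2 * b * m - b with _
  suffices 3 * t ^ 2 + r * t + s < 0 by linarith
  set u := N - m - 1 with _
  have hleft : 3 + r + s < 0 := by linarith
  have hright : 3 * u ^ 2 + 2 * r * u + 4 * s < 0 := by
    have hu' : 6 * b + 4 * m - 4 ≤ u := by linarith
    nlinarith [mul_le_mul hu' (show 2 * b + 4 * m - 2 ≤ u - 4 * b + 2 by linarith)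
      (by linarith) (by linarith), mul_pos (show 0 < b by linarith) (show 0 < m by linarith)]
  have hcomb : 4 * (u - 2) * (3 * t ^ 2 + r * t + s) =
      4 * (u - 2 * t) * (3 + r + s) + 2 * (t - 1) * (3 * u ^ 2 + 2 * r * u + 4 * s)
        - 6 * (t - 1) * (u - 2 * t) * (u - 2) := by ring
  rcases ht.eq_or_lt with rfl | ht
  · linarith
  have := mul_nonpos_of_nonneg_of_nonpos (show 0 ≤ u - 2 * t by linarith) hleft.le
  have := mul_neg_of_pos_of_neg (sub_pos.2 ht) hright
  have := mul_nonneg (mul_nonneg (sub_pos.2 ht).le (show 0 ≤ u - 2 * t by linarith))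
    (show 0 ≤ u - 2 by linarith)
  exact neg_of_mul_neg_right (show 4 * (u - 2) * (3 * t ^ 2 + r * t + s) < 0 by linarith)
    (by linarith)

lemma IsDegreeClosed.le_card_filter_degree_le (hcl : IsDegreeClosed G (N + m))
    (hm : 1 ≤ m) (hmb : m + 1 ≤ b) (hV : Fintype.card V = N + b)
    (h1 : 2 * b * m + b + 2 * m + 6 ≤ 2 * N) (h2 : 6 * b + 5 * m ≤ N + 3)
    (hE : N ^ 2 + b ≤ 2 * #G.edgeFinset + N) (hδ : ∀ v, m ≤ G.degree v) (hG : G ≠ ⊤) :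
    b ≤ #{v | G.degree v ≤ m} := by
  classical
  obtain ⟨t, htN, hcard⟩ := hcl.exists_le_card_filter_degree_le hV hδ hG
  rcases t.eq_zero_or_pos with rfl | ht
  · exact hcard
  obtain ⟨W, hW, hWcard⟩ := exists_subset_card_eq hcard
  have hWdeg : ∑ w ∈ W, G.degree w ≤ (b + t) * (m + t) := by
    rw [← hWcard, ← smul_eq_mul]
    exact sum_le_card_nsmul _ _ _ fun w hw ↦ (mem_filter.1 (hW hw)).2
  have hedges := two_mul_card_edgeFinset_add_card_compl_le (G := G) W
  have hcompl : (#Wᶜ : ℤ) = N - t := by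
    have := card_compl_add_card W
    lia
  zify at *
  rw [hcompl] at hedges
  linarith [sub_sq_add_two_mul_lt hm hmb h1 h2 ht (by linarith)]

lemma card_filter_degree_le_eq (hV : Fintype.card V = N + b)
    (h1 : 2 * b * m + b + 2 * m + 6 ≤ 2 * N)
    (hE : N ^ 2 + b ≤ 2 * #G.edgeFinset + N) (hb : b ≤ #{v | G.degree v ≤ m}) :
    #{v | G.degree v ≤ m} = b := by
  classical
  by_contra hne
  obtain ⟨W, hW, hWcard⟩ := exists_subset_card_eq (Nat.lt_of_le_of_ne hb (Ne.symm hne))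
  have hWdeg : ∑ w ∈ W, G.degree w ≤ (b + 1) * m := by
    rw [← Nat.succ_eq_add_one, ← hWcard, ← smul_eq_mul]
    exact sum_le_card_nsmul _ _ _ fun w hw ↦ (mem_filter.1 (hW hw)).2
  have hedges := two_mul_card_edgeFinset_add_card_compl_le (G := G) W
  obtain rfl : N = #Wᶜ + 1 := by
    have := card_compl_add_card W
    lia
  linarith

lemma IsDegreeClosed.adj_of_lt_degree (hcl : IsDegreeClosed G (N + m))
    (hV : Fintype.card V = N + b) (h1 : 2 * b * m + b + 2 * m + 6 ≤ 2 * N)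
    (hE : N ^ 2 + b ≤ 2 * #G.edgeFinset + N) (hb : #{v | G.degree v ≤ m} = b)
    {x y : V} (hx : m < G.degree x) (hy : m < G.degree y) (hxy : x ≠ y) : G.Adj x y := by
  classical
  by_contra hadj
  have hlt : G.degree x + G.degree y < N + m := by
    contrapose! hadj
    exact hcl hxy hadj
  let L : Finset V := {v | G.degree v ≤ m}
  have hyL : y ∉ L := by simp [L, hy]
  have hxL : x ∉ insert y L := by simp [L, hx, hxy]
  have hLdeg : ∑ v ∈ L, G.degree v ≤ b * m := by
    rw [← hb, ← smul_eq_mul]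
    exact sum_le_card_nsmul _ _ _ fun v hv ↦ (mem_filter.1 hv).2
  have hedges := two_mul_card_edgeFinset_add_card_compl_le (G := G) (insert x (insert y L))
  rw [sum_insert hxL, sum_insert hyL] at hedges
  obtain rfl : N = #(insert x (insert y L))ᶜ + 2 := by
    have := card_compl_add_card (insert x (insert y L))
    rw [card_insert_of_notMem hxL, card_insert_of_notMem hyL] at this
    lia
  linarith

lemma IsDegreeClosed.adj_of_adj_of_degree_le (hcl : IsDegreeClosed G (N + m))
    (hV : Fintype.card V = N + b) (hδ : ∀ v, m ≤ G.degree v)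
    (hb : #{v | G.degree v ≤ m} = b)
    (hclique : ∀ ⦃x y⦄, m < G.degree x → m < G.degree y → x ≠ y → G.Adj x y)
    {x w w' : V} (hx : m < G.degree x) (hw : G.degree w ≤ m) (hxw : G.Adj x w)
    (hw' : G.degree w' ≤ m) : G.Adj x w' := by
  classical
  refine hcl (by rintro rfl; lia) (add_le_add ?_ (hδ w'))
  let L : Finset V := {v | G.degree v ≤ m}
  have hL : #Lᶜ = N := by
    have := card_compl_add_card L
    lia
  have hxL : x ∈ Lᶜ := by simpa [L] using hx
  calc N = #(insert w (Lᶜ.erase x)) := by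
        rw [card_insert_of_notMem (by simp [L, hw]), card_erase_add_one hxL, hL]
    _ ≤ #(G.neighborFinset x) := card_le_card fun y hy ↦ by
        simp only [L, mem_insert, mem_erase, mem_compl, mem_filter_univ, not_le] at hy
        rw [mem_neighborFinset]
        rcases hy with rfl | ⟨hyx, hy⟩
        exacts [hxw, hclique hx hy hyx.symm]
    _ = G.degree x := G.card_neighborFinset_eq_degree x

lemma IsMConnected.exists_neighborFinset_eq (hconn : IsMConnected G m) {W : Finset V}
    (hW : W.Nonempty) (hdeg : ∀ w ∈ W, G.degree w ≤ m) (hcard : m + #W < Fintype.card V)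
    (hall : ∀ ⦃x w w'⦄, x ∉ W → w ∈ W → G.Adj x w → w' ∈ W → G.Adj x w') :
    ∃ S, Disjoint S W ∧ #S = m ∧ ∀ w ∈ W, G.neighborFinset w = S := by
  classical
  let S : Finset V := {x ∈ Wᶜ | ∃ w ∈ W, G.Adj x w}
  have hSW : Disjoint S W := disjoint_compl_left.mono_left (filter_subset _ _)
  have hsub {w} (hw : w ∈ W) : S ⊆ G.neighborFinset w := fun x hx ↦ by
    obtain ⟨hxW, w₀, hw₀, hxw₀⟩ := mem_filter.1 hx
    exact (G.mem_neighborFinset w x).2 (hall (mem_compl.1 hxW) hw₀ hxw₀ hw).symm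
  have hle {w} (hw : w ∈ W) : #(G.neighborFinset w) ≤ m :=
    (G.card_neighborFinset_eq_degree w).trans_le (hdeg w hw)
  obtain ⟨w, hw⟩ := hW
  have hmS : m ≤ #S := by
    by_contra! hlt
    obtain ⟨x, hx⟩ : ∃ x, x ∉ S ∪ W := by
      by_contra! h
      have := card_union_le S W
      rw [eq_univ_of_forall h, card_univ] at this
      lia
    rw [mem_union, not_or] at hx
    obtain ⟨y, hy, z, hz, -, hzS, hyz⟩ := hconn.exists_adj_of_card_lt hlt (A := (W : Set V))
      hw (disjoint_right.1 hSW hw) hx.2 hx.1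
    exact hzS (mem_filter.2 ⟨mem_compl.2 hz, y, hy, hyz.symm⟩)
  refine ⟨S, hSW, ((card_le_card (hsub hw)).trans (hle hw)).antisymm hmS, fun w' hw' ↦ ?_⟩
  exact (eq_of_subset_of_card_le (hsub hw') ((hle hw').trans hmS)).symm

/-- The two sets are the vertices of `K_m` and of `I_b` in the join `K_m ∨ (K_(N - m) + I_b)`. -/
theorem IsDegreeClosed.exists_adj_iff (hcl : IsDegreeClosed G (N + m)) (hconn : IsMConnected G m)
    (hm : 1 ≤ m) (hmb : m + 1 ≤ b) (hV : Fintype.card V = N + b)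
    (h1 : 2 * b * m + b + 2 * m + 6 ≤ 2 * N) (h2 : 6 * b + 5 * m ≤ N + 3)
    (hE : N ^ 2 + b ≤ 2 * #G.edgeFinset + N) (hG : G ≠ ⊤) :
    ∃ S W : Finset V, Disjoint S W ∧ #S = m ∧ #W = b ∧
      ∀ x y, G.Adj x y ↔ x ≠ y ∧ (x ∈ S ∨ y ∈ S ∨ (x ∉ W ∧ y ∉ W)) := by
  classical
  have hδ := hconn.le_degree
  let W : Finset V := {v | G.degree v ≤ m}
  have memW {v} : v ∈ W ↔ G.degree v ≤ m := mem_filter_univ v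
  have hWb : #W = b := card_filter_degree_le_eq hV h1 hE
    (hcl.le_card_filter_degree_le hm hmb hV h1 h2 hE hδ hG)
  have hclique ⦃x y⦄ (hx : m < G.degree x) (hy : m < G.degree y) (hxy : x ≠ y) : G.Adj x y :=
    hcl.adj_of_lt_degree hV h1 hE hWb hx hy hxy
  obtain ⟨S, hSW, hS, hN⟩ := hconn.exists_neighborFinset_eq (W := W)
    (card_pos.1 (by lia)) (fun w ↦ memW.1) (by lia) fun x w w' hx hw hxw hw' ↦
      hcl.adj_of_adj_of_degree_le hV hδ hWb hclique (not_le.1 (hx ∘ memW.2)) (memW.1 hw) hxw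
        (memW.1 hw')
  refine ⟨S, W, hSW, hS, hWb, fun x y ↦ ?_⟩
  have hadjW {w z} (hw : w ∈ W) : G.Adj w z ↔ z ∈ S := by rw [← hN w hw, mem_neighborFinset]
  have hadj {x y} (hx : x ∉ W) (hy : y ∉ W) : G.Adj x y ↔ x ≠ y :=
    ⟨fun h ↦ h.ne, hclique (not_le.1 (hx ∘ memW.2)) (not_le.1 (hy ∘ memW.2))⟩
  have hdisj {v} (hv : v ∈ S) : v ∉ W := disjoint_left.1 hSW hv
  by_cases hx : x ∈ W
  · rw [hadjW hx]
    grind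
  by_cases hy : y ∈ W
  · rw [G.adj_comm, hadjW hy]
    grind
  · rw [hadj hx hy]
    grind

end DegreeClosed

lemma nonempty_iso_joinGraph {V : Type*} [Fintype V] {G : SimpleGraph V} {m a b : ℕ}
    (hV : Fintype.card V = m + a + b) {S W : Finset V} (hSW : Disjoint S W) (hS : #S = m)
    (hW : #W = b)
    (hadj : ∀ x y, G.Adj x y ↔ x ≠ y ∧ (x ∈ S ∨ y ∈ S ∨ (x ∉ W ∧ y ∉ W))) :
    Nonempty (G ≃g joinGraph m a b) := by
  classical
  have hA : #(S ∪ W)ᶜ = a := by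
    rw [card_compl, card_union_of_disjoint hSW]
    lia
  let f : Fin m ⊕ (Fin a ⊕ Fin b) → V :=
    Sum.elim (fun i ↦ (S.equivFinOfCardEq hS).symm i)
      (Sum.elim (fun i ↦ ((S ∪ W)ᶜ.equivFinOfCardEq hA).symm i)
        fun i ↦ (W.equivFinOfCardEq hW).symm i)
  have hfS i : f (.inl i) ∈ S := Subtype.prop _
  have hfA i : f (.inr (.inl i)) ∉ S ∧ f (.inr (.inl i)) ∉ W := by
    rw [← not_or, ← mem_union, ← mem_compl]
    exact Subtype.prop _
  have hfW i : f (.inr (.inr i)) ∈ W := Subtype.prop _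
  have hfWS i : f (.inr (.inr i)) ∉ S := disjoint_right.1 hSW (hfW i)
  have hinj : f.Injective := by
    have hval {n : ℕ} {T : Finset V} (e : Fin n ≃ T) : (fun i ↦ (e i : V)).Injective :=
      Subtype.val_injective.comp e.injective
    refine (hval _).sumElim ((hval _).sumElim (hval _) ?_) ?_
    · exact fun i j (h : f (.inr (.inl i)) = f (.inr (.inr j))) ↦ (hfA i).2 (h ▸ hfW j)
    · rintro i (j | j)
      exacts [fun h : f (.inl i) = f (.inr (.inl j)) ↦ (hfA j).1 (h ▸ hfS i),
        fun h : f (.inl i) = f (.inr (.inr j)) ↦ hfWS j (h ▸ hfS i)]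
  have hbij : f.Bijective := (Fintype.bijective_iff_injective_and_card f).2 ⟨hinj, by simp; lia⟩
  refine ⟨Iso.symm ⟨.ofBijective f hbij, fun {x y} ↦ ?_⟩⟩
  rw [Equiv.ofBijective_apply, Equiv.ofBijective_apply, hadj, hinj.ne_iff]
  rcases x with i | i | i <;> rcases y with j | j | j <;>
    simp [joinGraph, join, hfS, hfA, hfW, hfWS]

theorem exists_le_iso_joinGraph {V : Type*} [Fintype V] {G : SimpleGraph V} [DecidableRel G.Adj]
    {m a b k : ℕ} (hm : 1 ≤ m) (hk : 2 ≤ k) (hb : (k - 1) * m + 1 = b)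
    (hV : Fintype.card V = m + a + b) (hconn : IsMConnected G m) (hno : ¬HasSpanningKTree G k)
    (h1 : 2 * b * m + b + 2 * m + 6 ≤ 2 * (m + a)) (h2 : 6 * b + 5 * m ≤ m + a + 3)
    (hE : (m + a) ^ 2 + b ≤ 2 * #G.edgeFinset + (m + a)) :
    ∃ G', G ≤ G' ∧ Nonempty (G' ≃g joinGraph m a b) := by
  classical
  obtain ⟨G', hGG', hmax⟩ :=
    (Set.toFinite {H : SimpleGraph V | ¬HasSpanningKTree H k}).exists_le_maximal hno
  have hno' : ¬HasSpanningKTree G' k := hmax.prop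
  have hconn' := hconn.mono hGG'
  have hb' : b = (k - 2) * m + m + 1 := by
    rw [← hb, ← Nat.succ_mul]
    congr
    lia
  have hcl : IsDegreeClosed G' (m + a + m) := by
    intro u v hne hle
    by_contra hadj
    have hT : HasSpanningKTree (G' ⊔ edge u v) k := by
      by_contra hT
      have hedge : edge u v ≤ G' := le_sup_right.trans (hmax.le_of_ge hT le_sup_left)
      exact hadj ((edge_le_iff _).1 hedge |>.resolve_left hne)
    have := degree_add_degree_add_le_of_hasSpanningKTree_sup_edge hconn' hk hno' hT
    lia
  have hG' : G' ≠ ⊤ := by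
    rintro rfl
    have : Nonempty V := (hconn.connected hm).nonempty
    exact hno' (hasSpanningKTree_top hk)
  obtain ⟨S, W, hSW, hS, hW, hadj⟩ := hcl.exists_adj_iff hconn' hm (by lia) hV h1 h2
    (hE.trans (by grw [edgeFinset_mono hGG'])) hG'
  exact ⟨G', hGG', nonempty_iso_joinGraph hV hSW hS hW hadj⟩

section SpectralRadius

open Matrix

lemma isHermitian_adjMatrix {V : Type*} (G : SimpleGraph V) [DecidableRel G.Adj] :
    (G.adjMatrix ℝ).IsHermitian :=
  (conjTranspose_eq_transpose_of_trivial _).trans G.isSymm_adjMatrix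

variable {V : Type*} [Fintype V] {G : SimpleGraph V} [DecidableRel G.Adj] {x : V → ℝ}

lemma specRadius_eq_sSup_spectrum [DecidableEq V] :
    specRadius G = sSup (spectrum ℝ (G.adjMatrix ℝ)) := by
  simp only [specRadius, Module.End.hasEigenvalue_iff_mem_spectrum, spectrum_toLin',
    Set.ofPred_mem_eq]
  convert! rfl

lemma isGreatest_specRadius [DecidableEq V] [Nonempty V] :
    IsGreatest (spectrum ℝ (G.adjMatrix ℝ)) (specRadius G) := by
  have hfin := Matrix.finite_spectrum (G.adjMatrix ℝ)
  rw [specRadius_eq_sSup_spectrum]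
  exact ⟨Set.Nonempty.csSup_mem
    ⟨_, (isHermitian_adjMatrix G).eigenvalues_mem_spectrum_real (Classical.arbitrary V)⟩ hfin,
    fun μ hμ ↦ le_csSup hfin.bddAbove hμ⟩

lemma specRadius_eq_of_iso {W : Type*} [Fintype W] {G : SimpleGraph V} {H : SimpleGraph W}
    (e : G ≃g H) : specRadius G = specRadius H := by
  classical
  rw [specRadius_eq_sSup_spectrum, specRadius_eq_sSup_spectrum, ← e.reindex_adjMatrix ℝ,
    ← coe_reindexAlgEquiv ℝ, AlgEquiv.spectrum_eq]

lemma exists_adjMatrix_mulVec_eq_specRadius_smul [Nonempty V] :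
    ∃ x : V → ℝ, x ≠ 0 ∧ G.adjMatrix ℝ *ᵥ x = specRadius G • x := by
  classical
  have h := (isGreatest_specRadius (G := G)).1
  rw [← spectrum_toLin', ← Module.End.hasEigenvalue_iff_mem_spectrum] at h
  obtain ⟨x, hx⟩ := h.exists_hasEigenvector
  exact ⟨x, hx.2, by simpa using hx.apply_eq_smul⟩

open scoped MatrixOrder in
lemma posSemidef_specRadius_sub_adjMatrix [DecidableEq V] :
    (algebraMap ℝ (Matrix V V ℝ) (specRadius G) - G.adjMatrix ℝ).PosSemidef := by
  cases isEmpty_or_nonempty V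
  · rw [Subsingleton.elim (_ - _) 0]
    exact .zero
  · exact le_algebraMap_of_spectrum_le (fun μ hμ ↦ isGreatest_specRadius.2 hμ)
      (isHermitian_adjMatrix G)

lemma dotProduct_adjMatrix_mulVec_le (x : V → ℝ) :
    x ⬝ᵥ G.adjMatrix ℝ *ᵥ x ≤ specRadius G * (x ⬝ᵥ x) := by
  classical
  have h := (posSemidef_specRadius_sub_adjMatrix (G := G)).dotProduct_mulVec_nonneg x
  simpa [sub_mulVec, Algebra.algebraMap_eq_smul_one, smul_mulVec] using h

lemma adjMatrix_mulVec_eq_of_le_dotProduct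
    (h : specRadius G * (x ⬝ᵥ x) ≤ x ⬝ᵥ G.adjMatrix ℝ *ᵥ x) :
    G.adjMatrix ℝ *ᵥ x = specRadius G • x := by
  classical
  have h' := h.antisymm' (dotProduct_adjMatrix_mulVec_le x)
  have h0 := (posSemidef_specRadius_sub_adjMatrix (G := G)).dotProduct_mulVec_zero_iff x
  simp only [sub_mulVec, Algebra.algebraMap_eq_smul_one, smul_mulVec, one_mulVec, dotProduct_sub,
    dotProduct_smul, star_trivial, smul_eq_mul, sub_eq_zero] at h0
  exact (h0.1 h'.symm).symm

lemma pos_of_adjMatrix_mulVec_eq_smul (hG : G.Connected) {μ : ℝ}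
    (hx : G.adjMatrix ℝ *ᵥ x = μ • x) (hx0 : x ≠ 0) (hnonneg : 0 ≤ x) (v : V) : 0 < x v := by
  refine (hnonneg v).lt_of_ne' fun hv ↦ hx0 (funext fun w ↦ ?_)
  have hstep {u w} (huw : G.Adj u w) (hu : x u = 0) : x w = 0 := by
    have hsum := congrFun hx u
    rw [adjMatrix_mulVec_apply, Pi.smul_apply, hu, smul_zero,
      sum_eq_zero_iff_of_nonneg fun w _ ↦ hnonneg w] at hsum
    exact hsum w ((G.mem_neighborFinset u w).2 huw)
  obtain ⟨p⟩ := hG v w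
  induction p with
  | nil => exact hv
  | cons huw _ ih => exact ih (hstep huw hv)

lemma dotProduct_adjMatrix_mulVec_lt {H : SimpleGraph V} [DecidableRel H.Adj] (hGH : G < H)
    (hx : ∀ v, 0 < x v) : x ⬝ᵥ G.adjMatrix ℝ *ᵥ x < x ⬝ᵥ H.adjMatrix ℝ *ᵥ x := by
  obtain ⟨u, v, hH, hG⟩ : ∃ u v, H.Adj u v ∧ ¬G.Adj u v := by
    by_contra! h
    exact hGH.not_ge h
  rw [dotProduct_mulVec_adjMatrix, dotProduct_mulVec_adjMatrix]
  have hle i j : (if G.Adj i j then x i * x j else 0) ≤ if H.Adj i j then x i * x j else 0 := by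
    have := (mul_pos (hx i) (hx j)).le
    have : G.Adj i j → H.Adj i j := fun h ↦ hGH.le h
    grind
  refine sum_lt_sum (fun i _ ↦ sum_le_sum fun j _ ↦ hle i j)
    ⟨u, mem_univ u, sum_lt_sum (fun j _ ↦ hle u j) ⟨v, mem_univ v, ?_⟩⟩
  rw [if_neg hG, if_pos hH]
  exact mul_pos (hx u) (hx v)

lemma dotProduct_adjMatrix_mulVec_le_abs {H : SimpleGraph V} [DecidableRel H.Adj] (hGH : G ≤ H) :
    x ⬝ᵥ G.adjMatrix ℝ *ᵥ x ≤ |x| ⬝ᵥ H.adjMatrix ℝ *ᵥ |x| := by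
  rw [dotProduct_mulVec_adjMatrix, dotProduct_mulVec_adjMatrix]
  refine sum_le_sum fun i _ ↦ sum_le_sum fun j _ ↦ ?_
  have : G.Adj i j → H.Adj i j := fun h ↦ hGH h
  have := le_abs_self (x i * x j)
  have := abs_nonneg (x i * x j)
  simp only [Pi.abs_apply, ← abs_mul]
  grind

/-- For an eigenvector `x` of the smaller graph, `|x|` attains the Rayleigh quotient of the larger
one, so it is a positive eigenvector there and every edge contributes to it. -/
theorem eq_of_specRadius_le {G H : SimpleGraph V} (hGH : G ≤ H) (hH : H.Connected)
    (h : specRadius H ≤ specRadius G) : G = H := by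
  classical
  have := hH.nonempty
  obtain ⟨x, hx0, hx⟩ := exists_adjMatrix_mulVec_eq_specRadius_smul (G := G)
  have hxx : |x| ⬝ᵥ |x| = x ⬝ᵥ x := sum_congr rfl fun v _ ↦ abs_mul_abs_self (x v)
  have hxG : x ⬝ᵥ G.adjMatrix ℝ *ᵥ x = specRadius G * (x ⬝ᵥ x) := by
    rw [hx, dotProduct_smul, smul_eq_mul]
  have hHG : specRadius H * (|x| ⬝ᵥ |x|) ≤ specRadius G * (x ⬝ᵥ x) := by
    rw [hxx]
    exact mul_le_mul_of_nonneg_right h (dotProduct_self_star_nonneg x)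
  have hxH := dotProduct_adjMatrix_mulVec_le_abs (x := x) hGH
  have heig : H.adjMatrix ℝ *ᵥ |x| = specRadius H • |x| :=
    adjMatrix_mulVec_eq_of_le_dotProduct (by linarith)
  have hpos := pos_of_adjMatrix_mulVec_eq_smul hH heig (by simpa using hx0) (abs_nonneg x)
  by_contra hne
  have hlt := dotProduct_adjMatrix_mulVec_lt (hGH.lt_of_ne hne) hpos
  have hle := dotProduct_adjMatrix_mulVec_le (G := G) |x|
  have hle' := dotProduct_adjMatrix_mulVec_le (G := H) |x|
  rw [hxx] at hle
  have := dotProduct_adjMatrix_mulVec_le_abs (x := x) (le_refl G)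
  linarith

lemma sq_mul_sq_le_of_adjMatrix_mulVec_eq_smul {μ : ℝ} (hx : G.adjMatrix ℝ *ᵥ x = μ • x) {v : V}
    (hv : 0 < G.degree v) :
    μ ^ 2 * x v ^ 2 ≤
      ∑ w ∈ G.neighborFinset v, x w ^ 2 + (G.degree v - 1) * (∑ w, x w ^ 2 - x v ^ 2) := by
  classical
  have hcauchy : (μ * x v) ^ 2 ≤ G.degree v * ∑ w ∈ G.neighborFinset v, x w ^ 2 := by
    rw [← smul_eq_mul, ← Pi.smul_apply, ← hx, adjMatrix_mulVec_apply]
    exact sq_sum_le_card_mul_sum_sq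
  have hsum : x v ^ 2 + ∑ w ∈ G.neighborFinset v, x w ^ 2 ≤ ∑ w, x w ^ 2 := by
    rw [← sum_insert (f := fun w ↦ x w ^ 2) (G.notMem_neighborFinset_self v)]
    exact sum_le_univ_sum_of_nonneg fun _ ↦ sq_nonneg _
  have hdeg : (0 : ℝ) ≤ G.degree v - 1 := sub_nonneg.2 (Nat.one_le_cast.2 hv)
  linarith [mul_le_mul_of_nonneg_left (le_sub_iff_add_le'.2 hsum) hdeg]

lemma sum_neighborFinset (f : V → ℝ) :
    ∑ v, ∑ w ∈ G.neighborFinset v, f w = ∑ v, G.degree v * f v := by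
  rw [sum_comm' (t' := univ) (s' := fun w ↦ G.neighborFinset w) (by simp [G.adj_comm])]
  simp

/-- Hong's bound, obtained by summing the Cauchy–Schwarz estimate at each vertex. -/
theorem specRadius_sq_add_card_le [Nonempty V] (hG : ∀ v, 0 < G.degree v) :
    specRadius G ^ 2 + Fintype.card V ≤ 2 * #G.edgeFinset + 1 := by
  obtain ⟨x, hx0, hx⟩ := exists_adjMatrix_mulVec_eq_specRadius_smul (G := G)
  have hpos : 0 < ∑ v, x v ^ 2 := by
    obtain ⟨v, hv⟩ := Function.ne_iff.1 hx0
    exact sum_pos' (fun _ _ ↦ sq_nonneg _) ⟨v, mem_univ v, sq_pos_of_ne_zero hv⟩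
  have hdeg : ∑ v, (G.degree v : ℝ) = 2 * #G.edgeFinset := by
    exact_mod_cast G.sum_degrees_eq_twice_card_edges
  refine le_of_mul_le_mul_right ?_ hpos
  have := sum_le_sum fun v (_ : v ∈ univ) ↦ sq_mul_sq_le_of_adjMatrix_mulVec_eq_smul hx (hG v)
  rw [← mul_sum, sum_add_distrib, sum_neighborFinset] at this
  simp only [mul_sub, sub_mul, one_mul, sum_sub_distrib, ← sum_mul, hdeg, sum_const, card_univ,
    nsmul_eq_mul] at this
  linarith

lemma card_sub_one_le_specRadius {G : SimpleGraph V} {s : Finset V} (hs : s.Nonempty)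
    (hG : G.IsClique s) : #s - 1 ≤ specRadius G := by
  classical
  let x : V → ℝ := fun v ↦ if v ∈ s then 1 else 0
  have hxx : x ⬝ᵥ x = #s := by simp [x, dotProduct]
  have hxG : (#s : ℝ) * (#s - 1) ≤ x ⬝ᵥ G.adjMatrix ℝ *ᵥ x := by
    calc (#s : ℝ) * (#s - 1) = ∑ v ∈ s, (#(s.erase v) : ℝ) := by
          rw [sum_congr rfl fun v hv ↦ cast_card_erase_of_mem hv, sum_const, nsmul_eq_mul]
      _ ≤ ∑ v ∈ s, (#(G.neighborFinset v ∩ s) : ℝ) := by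
          refine sum_le_sum fun v hv ↦ Nat.cast_le.2 (card_le_card fun w hw ↦ ?_)
          obtain ⟨hwv, hw⟩ := mem_erase.1 hw
          exact mem_inter.2 ⟨(G.mem_neighborFinset v w).2 (hG hv hw hwv.symm), hw⟩
      _ = x ⬝ᵥ G.adjMatrix ℝ *ᵥ x := by simp [x, dotProduct, adjMatrix_mulVec_apply]
  have := hxG.trans (dotProduct_adjMatrix_mulVec_le x)
  rw [hxx, mul_comm] at this
  exact le_of_mul_le_mul_right this (by exact_mod_cast hs.card_pos)

end SpectralRadius

lemma add_sub_one_le_specRadius_joinGraph {m : ℕ} (hm : 1 ≤ m) (a b : ℕ) :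
    (m + a : ℝ) - 1 ≤ specRadius (joinGraph m a b) := by
  classical
  let s : Finset (Fin m ⊕ (Fin a ⊕ Fin b)) := disjSum univ (univ.map .inl)
  have hcard : #s = m + a := by simp [s]
  have hs : (joinGraph m a b).IsClique s := by
    rintro (i | i | i) hi (j | j | j) hj hij <;> simp_all [s, joinGraph, join]
  exact_mod_cast hcard ▸ card_sub_one_le_specRadius (card_pos.1 (by lia)) hs

lemma sq_add_le_of_specRadius_joinGraph_le {V : Type*} [Fintype V] {G : SimpleGraph V}
    [DecidableRel G.Adj] {m a b : ℕ} (hm : 1 ≤ m) (hV : Fintype.card V = m + a + b)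
    (hdeg : ∀ v, 0 < G.degree v) (hρ : specRadius (joinGraph m a b) ≤ specRadius G) :
    (m + a) ^ 2 + b ≤ 2 * #G.edgeFinset + (m + a) := by
  have : Nonempty V := Fintype.card_pos_iff.1 (by lia)
  have hlow := (add_sub_one_le_specRadius_joinGraph hm a b).trans hρ
  have hm' : (1 : ℝ) ≤ m := by exact_mod_cast hm
  have hsq : ((m + a : ℝ) - 1) ^ 2 ≤ specRadius G ^ 2 :=
    pow_le_pow_left₀ (by linarith [a.cast_nonneg (α := ℝ)]) hlow 2
  have hHong := specRadius_sq_add_card_le hdeg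
  rw [hV] at hHong
  push_cast at hHong
  have : ((m + a : ℝ) ^ 2 + b) ≤ 2 * #G.edgeFinset + (m + a) := by linarith
  exact_mod_cast this

theorem hasSpanningKTree_or_iso_joinGraph {V : Type*} [Fintype V] {G : SimpleGraph V}
    {m a b k : ℕ} (hm : 1 ≤ m) (hk : 2 ≤ k) (hb : (k - 1) * m + 1 = b)
    (hV : Fintype.card V = m + a + b) (hconn : IsMConnected G m)
    (h1 : 2 * b * m + b + 2 * m + 6 ≤ 2 * (m + a)) (h2 : 6 * b + 5 * m ≤ m + a + 3)
    (hρ : specRadius (joinGraph m a b) ≤ specRadius G) :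
    HasSpanningKTree G k ∨ Nonempty (G ≃g joinGraph m a b) := by
  classical
  refine or_iff_not_imp_left.2 fun hno ↦ ?_
  have hE := sq_add_le_of_specRadius_joinGraph_le hm hV
    (fun v ↦ hm.trans (hconn.le_degree v)) hρ
  obtain ⟨G', hGG', ⟨e⟩⟩ := exists_le_iso_joinGraph hm hk hb hV hconn hno h1 h2 hE
  obtain rfl := eq_of_specRadius_le hGG' ((hconn.connected hm).mono hGG')
    ((specRadius_eq_of_iso e).trans_le hρ)
  exact ⟨e⟩

lemma exists_joinGraph_parameters {n m k : ℕ} (hk : 2 ≤ k)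
    (hbound : max ((7 * (k : ℝ) - 2) * m + 4)
      (((k : ℝ) - 1) * (m : ℝ) ^ 2 + 1 / 2 * (3 * (k : ℝ) + 1) * m + 9 / 2) ≤ (n : ℝ)) :
    ∃ a b, n - k * m - 1 = a ∧ k * m - m + 1 = b ∧ (k - 1) * m + 1 = b ∧ n = m + a + b ∧
      2 * b * m + b + 2 * m + 6 ≤ 2 * (m + a) ∧ 6 * b + 5 * m ≤ m + a + 3 := by
  obtain ⟨l, rfl⟩ := Nat.exists_eq_add_of_le' hk
  obtain ⟨hlin, hquad⟩ := max_le_iff.1 hbound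
  have hlin' : 7 * (l * m) + 12 * m + 4 ≤ n := by
    rify
    push_cast at hlin
    linarith
  have hquad' : 2 * ((l + 1) * m * m) + 3 * (l * m) + 7 * m + 9 ≤ 2 * n := by
    rify
    push_cast at hquad
    linarith
  have hkm : (l + 2) * m = l * m + 2 * m := by ring
  refine ⟨n - (l + 2) * m - 1, l * m + m + 1, rfl, by lia, by grind, by lia, ?_, by lia⟩
  rw [show n - (l + 2) * m - 1 = n - l * m - 2 * m - 1 by lia]
  have : 2 * (l * m + m + 1) * m = 2 * ((l + 1) * m * m) + 2 * m := by ring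
  lia

end SpanningKTree

theorem theorem1p11 {V : Type*} [Fintype V] (G : SimpleGraph V) (n m k : ℕ)
    (hm : 1 ≤ m) (hk : 2 ≤ k) (hn : Fintype.card V = n)
    (hbound : max ((7 * (k : ℝ) - 2) * m + 4)
      (((k : ℝ) - 1) * (m : ℝ) ^ 2 + 1 / 2 * (3 * (k : ℝ) + 1) * m + 9 / 2) ≤ (n : ℝ))
    (hconn : SpanningKTree.IsMConnected G m)
    (hρ : SpanningKTree.specRadius
        (SpanningKTree.joinGraph m (n - k * m - 1) (k * m - m + 1)) ≤
      SpanningKTree.specRadius G) :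
    SpanningKTree.HasSpanningKTree G k ↔
      ¬ Nonempty (G ≃g SpanningKTree.joinGraph m (n - k * m - 1) (k * m - m + 1)) := by
  obtain ⟨a, b, ha, hb, hb', hab, h1, h2⟩ := SpanningKTree.exists_joinGraph_parameters hk hbound
  rw [ha, hb] at hρ ⊢
  constructor
  · rintro hT ⟨e⟩
    exact SpanningKTree.not_hasSpanningKTree_joinGraph (by lia) hb'.le (hT.of_iso e)
  · intro hG
    exact (SpanningKTree.hasSpanningKTree_or_iso_joinGraph hm hk hb' (hn.trans hab) hconn h1 h2
      hρ).resolve_right hG
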